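/- Let $N\ge 0$, let $\mathbb H$ be a complex Hilbert space of dimension $2^N$, and let $c_1,\dots,c_N$ be operators on $\mathbb H$ satisfying the canonical anti-commutation relations $\{c_i,c_j\}=\{c_i^*,c_j^*\}=0$, $\{c_i,c_j^*\}=\delta_{ij}\mathbb I$. Let $V\in\mathbb C^{N\times N}$ be unitary. For $\beta>0$, $\mu\in\mathbb R$ and $\lambda\in\mathbb R^N$, put $\mathbf H=V\,\mathrm{Diag}(\lambda)\,V^*$, $H=\sum_{i,j}c_i^*\mathbf H_{ij}c_j$, $b_k=\sum_j\overline{V_{jk}}\,c_j$, and $$\rho_{\beta,\mu,\lambda}=\frac1Z\,e^{-\beta\left(H-\mu\sum_k b_k^*b_k\right)},\qquad Z=\operatorname{tr}e^{-\beta\left(H-\mu\sum_k b_k^*b_k\right)}.$$ Let $N_i=c_i^*c_i$ be the number operators. (1) Let $K=VDV^*$ with $D=\mathrm{Diag}(d_1,\dots,d_N)$ and $0<d_i<1$ for all $i$. Let $\beta>0$, $\mu\in\mathbb R$, and choose $\lambda$ such that $$\beta(\lambda_i-\mu)=\log\frac{1-d_i}{d_i}\qquad(1\le i\le N).$$ Then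 $\rho=\rho_{\beta,\mu,\lambda}$ is a state (a positive operator of trace one) and the $N_i$ are pairwise commuting orthogonal projections. Moreover Born's rule $\mathbb P(X_1=x_1,\dots,X_N=x_N)=\operatorname{tr}\left[\rho\,1_{\{x_1\}}(N_1)\cdots 1_{\{x_N\}}(N_N)\right]$ defines a random vector $X$ with values in $\{0,1\}^N$, and the random set $S=\{i: X_i=1\}$ is a determinantal point process with correlation kernel $K$, that is, $\mathbb P(T\subseteq S)=\det\left[(K_{ij})_{i,j\in T}\right]$ for all $T\subseteq\{1,\dots,N\}$. (2) Fix $\lambda_1\le\dots\le\lambda_N$, $\mu\in\mathbb R$ and $0\le r\le N$ with $\lambda_r<\mu<\lambda_{r+1}$ (an inequality involving $\lambda_0$ or $\lambda_{N+1}$ is void). For $\beta>0$ let $d_1(\beta)\ge\dots\ge d_N(\beta)$ be the numbers in $(0,1)$ with $\beta(\lambda_i-\mu)=\log\frac{1-d_i(\beta)}{d_i(\beta)}$, and let $K_\beta=V\,\mathrm{Diag}(d_1(\beta),\dots,d_N(\beta))\,V^*$. Then, as $\beta\to\infty$, $$K_\beta\longrightarrow V_{:,[r]}V_{:,[r]}^*,$$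 the projection kernel onto the first $r$ columns of $V$ (convergence in the space of $N\times N$ matrices, equivalently in Frobenius norm). -/

import Mathlib

open scoped Matrix

namespace Fermion

/-- The matrix `V Diag(d) V^*`. -/
noncomputable def hermitianOf {N : ℕ} (V : Matrix (Fin N) (Fin N) ℂ) (d : Fin N → ℝ) :
    Matrix (Fin N) (Fin N) ℂ :=
  V * Matrix.diagonal (fun k => (d k : ℂ)) * Vᴴ

section Quantum

variable {𝓗 : Type*} [NormedAddCommGroup 𝓗] [InnerProductSpace ℂ 𝓗] [CompleteSpace 𝓗]

/-- The canonical anti-commutation relations for `c 0, …, c (p - 1)` and their adjoints.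
Here `star` is the Hilbert space adjoint of a bounded operator. -/
def SatisfiesCAR {p : ℕ} (c : Fin p → 𝓗 →L[ℂ] 𝓗) : Prop :=
  ∀ i j, c i * c j + c j * c i = 0 ∧
    star (c i) * star (c j) + star (c j) * star (c i) = 0 ∧
    c i * star (c j) + star (c j) * c i = if i = j then 1 else 0

/-- The operator trace on a (finite-dimensional) Hilbert space. -/
noncomputable def tr (A : 𝓗 →L[ℂ] 𝓗) : ℂ :=
  LinearMap.trace ℂ 𝓗 (A : 𝓗 →ₗ[ℂ] 𝓗)

/-- A (possibly mixed) quantum state: a positive operator of trace one. -/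
def IsState (ρ : 𝓗 →L[ℂ] 𝓗) : Prop :=
  ρ.IsPositive ∧ tr ρ = 1

/-- The particle-number preserving quadratic Hamiltonian `∑ i j, c i ^* M i j c j`. -/
noncomputable def quadHamiltonian {N : ℕ} (c : Fin N → 𝓗 →L[ℂ] 𝓗)
    (M : Matrix (Fin N) (Fin N) ℂ) : 𝓗 →L[ℂ] 𝓗 :=
  ∑ i, ∑ j, M i j • (star (c i) * c j)

/-- The annihilation operators `b k = ∑ j, conj (U j k) c j` attached to the columns of `U`. -/
noncomputable def modeOp {N : ℕ} (c : Fin N → 𝓗 →L[ℂ] 𝓗)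
    (U : Matrix (Fin N) (Fin N) ℂ) (k : Fin N) : 𝓗 →L[ℂ] 𝓗 :=
  ∑ j, star (U j k) • c j

/-- The number operator `c i ^* c i`. -/
noncomputable def numberOp {N : ℕ} (c : Fin N → 𝓗 →L[ℂ] 𝓗) (i : Fin N) : 𝓗 →L[ℂ] 𝓗 :=
  star (c i) * c i

/-- The operator `exp (-β (H - μ ∑ k, b k ^* b k))`, where `H` is the quadratic Hamiltonian of the
Hermitian matrix `U Diag(lam) U^*` and the `b k` are the modes of `U`. -/
noncomputable def gibbsWeight {N : ℕ} (c : Fin N → 𝓗 →L[ℂ] 𝓗)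
    (U : Matrix (Fin N) (Fin N) ℂ) (lam : Fin N → ℝ) (β μ : ℝ) : 𝓗 →L[ℂ] 𝓗 :=
  NormedSpace.exp ((-(β : ℂ)) •
    (quadHamiltonian c (hermitianOf U lam) -
      (μ : ℂ) • ∑ k, star (modeOp c U k) * modeOp c U k))

/-- The Gaussian (Gibbs) state `Z⁻¹ exp (-β (H - μ ∑ k, b k ^* b k))`, with `Z` the trace of the
exponential. -/
noncomputable def gibbsState {N : ℕ} (c : Fin N → 𝓗 →L[ℂ] 𝓗)
    (U : Matrix (Fin N) (Fin N) ℂ) (lam : Fin N → ℝ) (β μ : ℝ) : 𝓗 →L[ℂ] 𝓗 :=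
  (tr (gibbsWeight c U lam β μ))⁻¹ • gibbsWeight c U lam β μ

/-- The spectral projector `1_{x}(A)` of a self-adjoint operator `A`: the orthogonal projection
onto the eigenspace of `A` for `x` (zero if `x` is not an eigenvalue). -/
noncomputable def spectralProj [FiniteDimensional ℂ 𝓗] (A : 𝓗 →L[ℂ] 𝓗) (x : ℝ) :
    𝓗 →L[ℂ] 𝓗 :=
  (Module.End.eigenspace (A : 𝓗 →ₗ[ℂ] 𝓗) (x : ℂ)).starProjection

/-- Born's rule for the joint measurement of commuting observables `A 0, …, A (p - 1)` in the
state `ρ`: the probability law `P` of the vector of outcomes satisfies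
`P (x) = tr (ρ 1_{x 0}(A 0) ⋯ 1_{x (p - 1)}(A (p - 1)))` for all `x`. -/
def IsBornLaw [FiniteDimensional ℂ 𝓗] {p : ℕ} (ρ : 𝓗 →L[ℂ] 𝓗)
    (A : Fin p → 𝓗 →L[ℂ] 𝓗) (P : PMF (Fin p → ℝ)) : Prop :=
  ∀ x : Fin p → ℝ,
    ((P x).toReal : ℂ) = tr (ρ * (List.ofFn fun j => spectralProj (A j) (x j)).prod)

end Quantum

/-- The set of indices at which the measurement outcome is `1`. -/
noncomputable def occupied {N : ℕ} (x : Fin N → ℝ) : Finset (Fin N) :=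
  Finset.univ.filter fun i => x i = 1

/-- `Q` is the law of a determinantal point process on `Fin N` with correlation kernel `K`:
`ℙ (S ⊆ Y) = det (K_S)` for all `S`. -/
def IsDPP {N : ℕ} (K : Matrix (Fin N) (Fin N) ℂ) (Q : PMF (Finset (Fin N))) : Prop :=
  ∀ S : Finset (Fin N),
    ((Q.toOuterMeasure {Y | S ⊆ Y}).toReal : ℂ) =
      (K.submatrix (fun i : S => (i : Fin N)) (fun i : S => (i : Fin N))).det

/-- The projection kernel onto the span of the first `r` columns of `V`. -/
def firstColumnsProj {N : ℕ} (V : Matrix (Fin N) (Fin N) ℂ) {r : ℕ} (hr : r ≤ N) :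
    Matrix (Fin N) (Fin N) ℂ :=
  V.submatrix id (Fin.castLE hr) * (V.submatrix id (Fin.castLE hr))ᴴ

end Fermion

/-! The correlation functions of a Gibbs state are computed by Wick's theorem. The modes `b k` again
satisfy the CAR, and the Gibbs exponent is `A = ∑ a k • (b k)^* b k` with `a k = -β(λ k - μ)`, so
`exp A` moves past `(b k)^*` at the cost of the scalar `exp (a k)`. Cyclicity of the trace turns
this into a KMS relation (`SatisfiesCAR.expectation_star_modeOp_mul`), and the choice of `λ` makes
its coefficient `d k`. Together with the CAR it gives `SatisfiesCAR.wick`: expectations of normally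
ordered products are minors of `V Diag(d) V^*`.

The `N i` are commuting projections, so the Born weights are expectations of projections, hence
nonnegative. Summing them over the outcomes equal to 1 on `S` leaves the expectation of `∏ N i` over
`S`, a normally ordered product, hence a principal minor.

For the limit, `d i = 1 / (1 + exp (β(λ i - μ)))` tends to 1 below `μ` and to 0 above it, and the
kernel depends continuously on `d`. -/

namespace Fermion

open scoped ComplexOrder

/-! ### CAR algebra and Wick's theorem. -/

section Algebra

variable {𝓗 : Type*} [NormedAddCommGroup 𝓗] [InnerProductSpace ℂ 𝓗] [CompleteSpace 𝓗]
variable {N : ℕ} {c : Fin N → 𝓗 →L[ℂ] 𝓗} {V : Matrix (Fin N) (Fin N) ℂ}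

theorem star_modeOp (k : Fin N) : star (modeOp c V k) = ∑ j, V j k • star (c j) := by
  simp [modeOp, star_sum, star_smul]

theorem SatisfiesCAR.modeOp_mul_star (hc : SatisfiesCAR c) (k i : Fin N) :
    modeOp c V k * star (c i) = star (V i k) • 1 - star (c i) * modeOp c V k := by
  rw [eq_sub_iff_add_eq, modeOp, Finset.sum_mul, Finset.mul_sum, ← Finset.sum_add_distrib]
  simp_rw [smul_mul_assoc, mul_smul_comm, ← smul_add, (hc _ _).2.2]
  simp

theorem SatisfiesCAR.star_modeOp_mul_star (hc : SatisfiesCAR c) (k i : Fin N) :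
    star (modeOp c V k) * star (c i) = -(star (c i) * star (modeOp c V k)) := by
  rw [eq_neg_iff_add_eq_zero, star_modeOp, Finset.sum_mul, Finset.mul_sum,
    ← Finset.sum_add_distrib]
  simp_rw [smul_mul_assoc, mul_smul_comm, ← smul_add, (hc _ _).2.1]
  simp

theorem star_eq_sum_star_modeOp (hV : V ∈ Matrix.unitaryGroup (Fin N) ℂ) (i : Fin N) :
    star (c i) = ∑ k, star (V i k) • star (modeOp c V k) := by
  have h := Matrix.mem_unitaryGroup_iff.1 hV
  simp_rw [star_modeOp, Finset.smul_sum, smul_smul]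
  rw [Finset.sum_comm]
  simp_rw [← Finset.sum_smul]
  have h2 : ∀ j, ∑ k, star (V i k) * V j k = if j = i then 1 else 0 := fun j => by
    rw [← Matrix.one_apply, ← h, Matrix.mul_apply]
    exact Finset.sum_congr rfl fun k _ => mul_comm _ _
  simp only [h2, ite_smul, one_smul, zero_smul, Finset.sum_ite_eq',
    Finset.mem_univ, if_true]

/-- The product `c (i 0)^* ⋯ c (i (m - 1))^*`. -/
noncomputable def creationString (c : Fin N → 𝓗 →L[ℂ] 𝓗) {m : ℕ} (i : Fin m → Fin N) :
    𝓗 →L[ℂ] 𝓗 :=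
  (List.ofFn fun a => star (c (i a))).prod

@[simp] theorem creationString_zero (i : Fin 0 → Fin N) : creationString c i = 1 := by
  simp [creationString]

theorem creationString_succ {m : ℕ} (i : Fin (m + 1) → Fin N) :
    creationString c i = star (c (i 0)) * creationString c (fun a => i a.succ) := by
  simp [creationString, List.ofFn_succ]

theorem SatisfiesCAR.star_modeOp_mul_creationString (hc : SatisfiesCAR c) (k : Fin N) {m : ℕ}
    (i : Fin m → Fin N) :
    star (modeOp c V k) * creationString c i =
      (-1 : ℂ) ^ m • (creationString c i * star (modeOp c V k)) := by
  induction m with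
  | zero => simp
  | succ m ih =>
    rw [creationString_succ, ← mul_assoc, hc.star_modeOp_mul_star, neg_mul, mul_assoc, ih,
      mul_smul_comm, mul_assoc, pow_succ]
    simp

theorem SatisfiesCAR.modeOp_mul_creationString (hc : SatisfiesCAR c) (k : Fin N) {m : ℕ}
    (i : Fin (m + 1) → Fin N) :
    modeOp c V k * creationString c i =
      ∑ l : Fin (m + 1),
          ((-1 : ℂ) ^ (l : ℕ) * star (V (i l) k)) • creationString c (i ∘ l.succAbove) +
        (-1 : ℂ) ^ (m + 1) • (creationString c i * modeOp c V k) := by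
  induction m with
  | zero =>
    rw [creationString_succ, ← mul_assoc, hc.modeOp_mul_star]
    simp [sub_eq_add_neg]
  | succ m ih =>
    rw [creationString_succ, ← mul_assoc, hc.modeOp_mul_star, sub_mul, mul_assoc, ih, mul_add,
      Finset.mul_sum, Fin.sum_univ_succ (n := m + 1)]
    simp_rw [mul_smul_comm]
    have h1 : ∀ l : Fin (m + 1), creationString c (i ∘ l.succ.succAbove) =
        star (c (i 0)) * creationString c ((fun a => i a.succ) ∘ l.succAbove) := fun l => by
      rw [creationString_succ]
      simp [Function.comp_def]
    have h2 : i ∘ (0 : Fin (m + 2)).succAbove = fun a => i a.succ := by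
      ext a; simp
    simp_rw [h1, h2]
    simp only [Fin.val_zero, pow_zero, one_mul, smul_mul_assoc, Fin.val_succ, pow_succ _ (_ + 1),
      mul_neg, mul_one, neg_smul, ← mul_assoc, pow_succ _ (Fin.val _), neg_mul,
      Finset.sum_neg_distrib]
    abel

theorem SatisfiesCAR.star_creationString_mul_star_modeOp (hc : SatisfiesCAR c) (k : Fin N)
    {m : ℕ} (i : Fin (m + 1) → Fin N) :
    star (creationString c i) * star (modeOp c V k) =
      ∑ l : Fin (m + 1),
          ((-1 : ℂ) ^ (l : ℕ) * V (i l) k) • star (creationString c (i ∘ l.succAbove)) +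
        (-1 : ℂ) ^ (m + 1) • (star (modeOp c V k) * star (creationString c i)) := by
  rw [← star_mul, hc.modeOp_mul_creationString k i]
  simp [star_sum, star_smul]

/-- Wick's theorem for a functional satisfying the KMS-type relation
`φ (b k ^* X) = d k φ (b k ^* X + X b k ^*)`. -/
theorem SatisfiesCAR.wick (hc : SatisfiesCAR c) (hV : V ∈ Matrix.unitaryGroup (Fin N) ℂ)
    (d : Fin N → ℝ) (φ : (𝓗 →L[ℂ] 𝓗) →ₗ[ℂ] ℂ) (hφ1 : φ 1 = 1)
    (hφ : ∀ k X, φ (star (modeOp c V k) * X) =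
      d k * (φ (star (modeOp c V k) * X) + φ (X * star (modeOp c V k))))
    {m : ℕ} (i j : Fin m → Fin N) :
    φ (creationString c i * star (creationString c j)) =
      ((hermitianOf V d).submatrix j i).det := by
  induction m with
  | zero => simp [hφ1]
  | succ m ih =>
    have key : ∀ k, φ (star (modeOp c V k) *
        (creationString c (fun a => i a.succ) * star (creationString c j))) =
        d k * ∑ l : Fin (m + 1), ((-1 : ℂ) ^ (l : ℕ) * V (j l) k) *
          ((hermitianOf V d).submatrix (j ∘ l.succAbove) (fun a => i a.succ)).det := by
      intro k
      rw [hφ, ← map_add]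
      congr 1
      -- Carrying `(b k)^*` through all factors gives the sign `(-1)^m (-1)^(m+1) = -1`, so the two
      -- full products cancel and only contractions with the `c (j l)` survive. Their signs are
      -- those of the Laplace expansion along column 0.
      rw [mul_assoc (creationString c _), hc.star_creationString_mul_star_modeOp, mul_add,
        Finset.mul_sum, ← mul_assoc (star _), hc.star_modeOp_mul_creationString, mul_smul_comm,
        smul_mul_assoc, mul_assoc (creationString c _) (star (modeOp c V k)), pow_succ,
        add_comm, add_assoc, ← add_smul]
      simp only [mul_neg, mul_one, neg_add_cancel, zero_smul, add_zero, map_sum, mul_smul_comm,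
        map_smul, ih, smul_eq_mul]
    rw [creationString_succ, mul_assoc, star_eq_sum_star_modeOp hV, Finset.sum_mul, map_sum,
      Matrix.det_succ_column_zero]
    simp_rw [smul_mul_assoc, map_smul, key, smul_eq_mul, Finset.mul_sum]
    rw [Finset.sum_comm]
    refine Finset.sum_congr rfl fun l _ => ?_
    have : hermitianOf V d (j l) (i 0) = ∑ k, V (j l) k * d k * star (V (i 0) k) := by
      simp [hermitianOf, Matrix.mul_apply, Matrix.diagonal_apply]
    simp only [Matrix.submatrix_apply, this, Matrix.submatrix_submatrix, Function.comp_def,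
      Finset.mul_sum, Finset.sum_mul]
    refine Finset.sum_congr rfl fun k _ => ?_
    ring

theorem SatisfiesCAR.isStarProjection_numberOp (hc : SatisfiesCAR c) (i : Fin N) :
    IsStarProjection (numberOp c i) := by
  have h0 : c i * c i = 0 := by
    have h := (hc i i).1
    rw [← two_smul ℂ] at h
    exact (smul_eq_zero.1 h).resolve_left two_ne_zero
  have h1 : c i * star (c i) = 1 - star (c i) * c i := by
    rw [eq_sub_iff_add_eq]; simpa using (hc i i).2.2
  refine ⟨?_, ?_⟩
  · rw [IsIdempotentElem, numberOp, mul_assoc, ← mul_assoc (c i), h1, sub_mul, mul_assoc, h0]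
    simp
  · simp [IsSelfAdjoint, numberOp]

theorem SatisfiesCAR.commute_numberOp_star (hc : SatisfiesCAR c) {i j : Fin N} (hij : i ≠ j) :
    Commute (numberOp c i) (star (c j)) := by
  have h1 : c i * star (c j) = -(star (c j) * c i) := by
    rw [eq_neg_iff_add_eq_zero, (hc i j).2.2, if_neg hij]
  have h2 : star (c i) * star (c j) = -(star (c j) * star (c i)) := by
    rw [eq_neg_iff_add_eq_zero, (hc i j).2.1]
  rw [Commute, SemiconjBy, numberOp, mul_assoc, h1, mul_neg, ← mul_assoc, h2]
  simp [mul_assoc]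

theorem SatisfiesCAR.commute_numberOp (hc : SatisfiesCAR c) (i j : Fin N) :
    Commute (numberOp c i) (numberOp c j) := by
  rcases eq_or_ne i j with rfl | hij
  · exact Commute.refl _
  · have h := hc.commute_numberOp_star hij
    have h' := h.star_star
    rw [star_star, (hc.isStarProjection_numberOp i).isSelfAdjoint.star_eq] at h'
    exact h.mul_right h'

/-- The adjoint reverses the string, so the pairs `c^*`, `c` are nested. The inner number operators
have other indices and commute with the outer `c^*`, so each pair can be closed up without a sign.
-/
theorem SatisfiesCAR.creationString_mul_star (hc : SatisfiesCAR c) {m : ℕ} (i : Fin m → Fin N)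
    (hi : Function.Injective i) :
    creationString c i * star (creationString c i) =
      (List.ofFn fun a => numberOp c (i a)).prod := by
  induction m with
  | zero => simp
  | succ m ih =>
    have hcomm : Commute (List.ofFn fun a : Fin m => numberOp c (i a.succ)).prod
        (star (c (i 0))) := by
      refine Commute.list_prod_left _ _ fun x hx => ?_
      obtain ⟨a, rfl⟩ := List.mem_ofFn.1 hx
      exact hc.commute_numberOp_star (hi.ne (Fin.succ_ne_zero a))
    have hcomm' : Commute (List.ofFn fun a : Fin m => numberOp c (i a.succ)).prod
        (numberOp c (i 0)) := by
      refine Commute.list_prod_left _ _ fun x hx => ?_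
      obtain ⟨a, rfl⟩ := List.mem_ofFn.1 hx
      exact hc.commute_numberOp _ _
    rw [creationString_succ, star_mul, star_star, mul_assoc, ← mul_assoc (creationString c _),
      ih (fun a => i a.succ) (hi.comp (Fin.succ_injective _)), ← mul_assoc, ← hcomm.eq, mul_assoc]
    change _ * numberOp c (i 0) = _
    rw [hcomm'.eq, List.ofFn_succ, List.prod_cons]

end Algebra

/-! ### Trace and positivity. -/

section Trace

variable {𝓗 : Type*} [NormedAddCommGroup 𝓗] [InnerProductSpace ℂ 𝓗]

theorem tr_mul_comm (A B : 𝓗 →L[ℂ] 𝓗) : tr (A * B) = tr (B * A) :=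
  LinearMap.trace_mul_comm ℂ _ _

theorem tr_smul (a : ℂ) (A : 𝓗 →L[ℂ] 𝓗) : tr (a • A) = a * tr A := by
  simp [tr]

theorem tr_nonneg {A : 𝓗 →L[ℂ] 𝓗} (hA : A.IsPositive) : 0 ≤ tr A :=
  LinearMap.IsPositive.trace_nonneg hA

/-- The trace is the sum of `‖B e‖²` over an orthonormal basis; if it vanished, `B` would kill a
unit vector. -/
theorem tr_star_mul_self_pos [CompleteSpace 𝓗] [FiniteDimensional ℂ 𝓗] [Nontrivial 𝓗]
    {B : 𝓗 →L[ℂ] 𝓗} (hB : IsUnit B) :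
    0 < tr (star B * B) := by
  have hpos : (star B * B).IsPositive := B.isPositive_adjoint_comp_self
  refine lt_of_le_of_ne (tr_nonneg hpos) fun h0 => ?_
  have h1 := LinearMap.trace_eq_sum_inner ((star B * B : 𝓗 →L[ℂ] 𝓗) : 𝓗 →ₗ[ℂ] 𝓗)
    (stdOrthonormalBasis ℂ 𝓗)
  rw [show LinearMap.trace ℂ 𝓗 _ = tr (star B * B) from rfl, ← h0, eq_comm] at h1
  have h2 := (Finset.sum_eq_zero_iff_of_nonneg fun i _ => hpos.inner_nonneg_right _).1 h1
  have hfin : 0 < Module.finrank ℂ 𝓗 := Module.finrank_pos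
  set e := stdOrthonormalBasis ℂ 𝓗 ⟨0, hfin⟩ with he
  have h3 : inner ℂ (B e) (B e) = 0 := by
    have := h2 ⟨0, hfin⟩ (Finset.mem_univ _)
    simpa [ContinuousLinearMap.star_eq_adjoint, ContinuousLinearMap.adjoint_inner_right] using this
  obtain ⟨C, hC⟩ := hB.exists_left_inv
  have h4 : e = 0 := by
    have := congrArg (fun T : 𝓗 →L[ℂ] 𝓗 => T e) hC
    simpa [inner_self_eq_zero.1 h3] using this.symm
  have := (stdOrthonormalBasis ℂ 𝓗).norm_eq_one ⟨0, hfin⟩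
  rw [← he, h4] at this
  simp at this

/-- The expectation functional `X ↦ tr (ρ X)`. -/
noncomputable def expectation (ρ : 𝓗 →L[ℂ] 𝓗) : (𝓗 →L[ℂ] 𝓗) →ₗ[ℂ] ℂ where
  toFun X := tr (ρ * X)
  map_add' X Y := by simp [tr, mul_add]
  map_smul' a X := by rw [mul_smul_comm, tr_smul]; rfl

theorem expectation_apply (ρ X : 𝓗 →L[ℂ] 𝓗) : expectation ρ X = tr (ρ * X) := rfl

theorem expectation_nonneg [CompleteSpace 𝓗] {ρ p : 𝓗 →L[ℂ] 𝓗} (hρ : ρ.IsPositive)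
    (hp : IsStarProjection p) :
    0 ≤ expectation ρ p := by
  -- Cyclicity and `p² = p` replace `ρ p` by a compression of `ρ`, which is positive.
  have h : expectation ρ p = tr (star p * ρ * p) := by
    rw [hp.isSelfAdjoint.star_eq, mul_assoc, tr_mul_comm p, mul_assoc, hp.isIdempotentElem.eq,
      expectation_apply]
  rw [h]
  exact tr_nonneg (hρ.adjoint_conj p)

end Trace

/-! ### The Gibbs state and its KMS relation. -/

section Gibbs

variable {𝓗 : Type*} [NormedAddCommGroup 𝓗] [InnerProductSpace ℂ 𝓗] [CompleteSpace 𝓗]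
variable {N : ℕ} {c : Fin N → 𝓗 →L[ℂ] 𝓗} {V : Matrix (Fin N) (Fin N) ℂ}

theorem quadHamiltonian_hermitianOf (d : Fin N → ℝ) :
    quadHamiltonian c (hermitianOf V d) =
      ∑ k, (d k : ℂ) • (star (modeOp c V k) * modeOp c V k) := by
  have h : ∀ i j, hermitianOf V d i j = ∑ k, V i k * d k * star (V j k) := fun i j => by
    simp [hermitianOf, Matrix.mul_apply, Matrix.diagonal_apply]
  simp only [star_modeOp]
  simp only [quadHamiltonian, h, modeOp, Finset.sum_mul, Finset.mul_sum,
    Finset.smul_sum, Finset.sum_smul, smul_mul_assoc, mul_smul_comm, smul_smul]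
  rw [Finset.sum_congr rfl fun _ _ => Finset.sum_comm, Finset.sum_comm]
  refine Finset.sum_congr rfl fun k _ => Finset.sum_comm.trans <| Finset.sum_congr rfl fun i _ =>
    Finset.sum_congr rfl fun j _ => ?_
  congr 1
  ring

theorem SatisfiesCAR.modeOp_mul_star_modeOp (hc : SatisfiesCAR c)
    (hV : V ∈ Matrix.unitaryGroup (Fin N) ℂ) (k l : Fin N) :
    modeOp c V l * star (modeOp c V k) =
      (if k = l then 1 else 0) - star (modeOp c V k) * modeOp c V l := by
  have h := Matrix.mem_unitaryGroup_iff'.1 hV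
  have h2 : ∑ j, V j k * star (V j l) = if k = l then 1 else 0 := by
    simp_rw [eq_comm (a := k)]
    rw [← Matrix.one_apply, ← h, Matrix.mul_apply]
    exact Finset.sum_congr rfl fun k _ => mul_comm _ _
  rw [star_modeOp, Finset.mul_sum, Finset.sum_mul]
  simp_rw [mul_smul_comm, hc.modeOp_mul_star, smul_sub, smul_smul, Finset.sum_sub_distrib,
    ← Finset.sum_smul, h2, smul_mul_assoc]
  simp

theorem SatisfiesCAR.star_modeOp_mul_star_modeOp (hc : SatisfiesCAR c) (k l : Fin N) :
    star (modeOp c V k) * star (modeOp c V l) =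
      -(star (modeOp c V l) * star (modeOp c V k)) := by
  rw [star_modeOp l, Finset.mul_sum, Finset.sum_mul, ← Finset.sum_neg_distrib]
  simp_rw [mul_smul_comm, smul_mul_assoc, hc.star_modeOp_mul_star, smul_neg]

theorem SatisfiesCAR.sum_smul_mul_star_modeOp (hc : SatisfiesCAR c)
    (hV : V ∈ Matrix.unitaryGroup (Fin N) ℂ) (a : Fin N → ℂ) (k : Fin N) :
    (∑ l, a l • (star (modeOp c V l) * modeOp c V l)) * star (modeOp c V k) =
      star (modeOp c V k) *
        ((∑ l, a l • (star (modeOp c V l) * modeOp c V l)) + a k • 1) := by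
  have h : ∀ l, star (modeOp c V l) * modeOp c V l * star (modeOp c V k) =
      (if k = l then star (modeOp c V k) else 0) +
        star (modeOp c V k) * (star (modeOp c V l) * modeOp c V l) := fun l => by
    rw [mul_assoc, hc.modeOp_mul_star_modeOp hV, mul_sub, ← mul_assoc,
      hc.star_modeOp_mul_star_modeOp l k]
    split_ifs with hkl
    · subst hkl; simp [mul_assoc]
    · simp [mul_assoc]
  simp_rw [Finset.sum_mul, smul_mul_assoc, h, smul_add, Finset.sum_add_distrib, mul_add,
    Finset.mul_sum, mul_smul_comm]
  simp [add_comm]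

theorem gibbsWeight_eq (lam : Fin N → ℝ) (β μ : ℝ) :
    gibbsWeight c V lam β μ = NormedSpace.exp
      (∑ k, ((-(β * (lam k - μ)) : ℝ) : ℂ) • (star (modeOp c V k) * modeOp c V k)) := by
  rw [gibbsWeight, quadHamiltonian_hermitianOf, Finset.smul_sum, ← Finset.sum_sub_distrib,
    Finset.smul_sum]
  congr 1
  refine Finset.sum_congr rfl fun k _ => ?_
  rw [← sub_smul, smul_smul]
  push_cast
  ring_nf

theorem SatisfiesCAR.gibbsWeight_mul_star_modeOp (hc : SatisfiesCAR c)
    (hV : V ∈ Matrix.unitaryGroup (Fin N) ℂ) (lam : Fin N → ℝ) (β μ : ℝ) (k : Fin N) :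
    gibbsWeight c V lam β μ * star (modeOp c V k) =
      (Real.exp (-(β * (lam k - μ))) : ℂ) • (star (modeOp c V k) * gibbsWeight c V lam β μ) := by
  let +nondep : NormedAlgebra ℚ (𝓗 →L[ℂ] 𝓗) := .restrictScalars ℚ ℂ _
  rw [gibbsWeight_eq]
  set a : Fin N → ℂ := fun k => ((-(β * (lam k - μ)) : ℝ) : ℂ) with ha
  -- `A (b k)^* = (b k)^* (A + a k)`; this intertwining passes to exponentials, and the scalar `a k`
  -- splits off.
  have h : SemiconjBy (star (modeOp c V k))
      ((∑ l, a l • (star (modeOp c V l) * modeOp c V l)) + a k • 1)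
      (∑ l, a l • (star (modeOp c V l) * modeOp c V l)) :=
    (hc.sum_smul_mul_star_modeOp hV a k).symm
  rw [← h.exp_right.eq, NormedSpace.exp_add_of_commute ((Commute.one_right _).smul_right _)]
  have h1 : NormedSpace.exp (a k • (1 : 𝓗 →L[ℂ] 𝓗)) = Complex.exp (a k) • 1 := by
    rw [← Algebra.algebraMap_eq_smul_one, ← Algebra.algebraMap_eq_smul_one,
      ← NormedSpace.algebraMap_exp_comm, Complex.exp_eq_exp_ℂ]
  rw [h1, mul_smul_comm, mul_one, mul_smul_comm, Complex.ofReal_exp]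

theorem exists_isUnit_gibbsWeight_eq (lam : Fin N → ℝ) (β μ : ℝ) :
    ∃ B : 𝓗 →L[ℂ] 𝓗, IsUnit B ∧ gibbsWeight c V lam β μ = star B * B := by
  let +nondep : NormedAlgebra ℚ (𝓗 →L[ℂ] 𝓗) := .restrictScalars ℚ ℂ _
  -- Half of the Gibbs exponent, so that its exponential is a self-adjoint invertible square root of
  -- the weight.
  set A := ∑ k, ((-(β * (lam k - μ)) / 2 : ℝ) : ℂ) • (star (modeOp c V k) * modeOp c V k) with hA
  have hs : IsSelfAdjoint A := by
    refine isSelfAdjoint_sum _ fun k _ => IsSelfAdjoint.smul ?_ (IsSelfAdjoint.star_mul_self _)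
    simp [IsSelfAdjoint]
  refine ⟨NormedSpace.exp A, NormedSpace.isUnit_exp A, ?_⟩
  rw [hs.exp.star_eq, ← NormedSpace.exp_add_of_commute (Commute.refl A), gibbsWeight_eq, hA,
    ← Finset.sum_add_distrib]
  congr 1
  refine Finset.sum_congr rfl fun k _ => ?_
  rw [← add_smul]
  push_cast
  ring_nf

theorem SatisfiesCAR.expectation_star_modeOp_mul (hc : SatisfiesCAR c)
    (hV : V ∈ Matrix.unitaryGroup (Fin N) ℂ) {d : Fin N → ℝ} (hd : ∀ i, 0 < d i ∧ d i < 1)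
    {β μ : ℝ} {lam : Fin N → ℝ} (h : ∀ i, β * (lam i - μ) = Real.log ((1 - d i) / d i))
    (k : Fin N) (X : 𝓗 →L[ℂ] 𝓗) :
    expectation (gibbsState c V lam β μ) (star (modeOp c V k) * X) =
      d k * (expectation (gibbsState c V lam β μ) (star (modeOp c V k) * X) +
        expectation (gibbsState c V lam β μ) (X * star (modeOp c V k))) := by
  obtain ⟨h0, h1⟩ := hd k
  have hexp : Real.exp (-(β * (lam k - μ))) = d k / (1 - d k) := by
    rw [h, Real.exp_neg, Real.exp_log (div_pos (by linarith) h0), inv_div]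
  have hkms : expectation (gibbsState c V lam β μ) (star (modeOp c V k) * X) =
      (d k / (1 - d k) : ℝ) *
        expectation (gibbsState c V lam β μ) (X * star (modeOp c V k)) := by
    rw [expectation_apply, expectation_apply, gibbsState, ← mul_assoc, smul_mul_assoc,
      hc.gibbsWeight_mul_star_modeOp hV, hexp, ← mul_assoc, tr_mul_comm _ (star _), ← mul_assoc,
      mul_smul_comm, smul_mul_assoc, smul_mul_assoc, smul_mul_assoc, tr_smul, tr_smul, tr_smul]
    ring
  rw [hkms]
  have : (1 - d k : ℂ) ≠ 0 := by
    exact_mod_cast (sub_pos.2 h1).ne'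
  push_cast
  field_simp
  ring

variable [FiniteDimensional ℂ 𝓗]

theorem tr_gibbsWeight_pos [Nontrivial 𝓗] (lam : Fin N → ℝ) (β μ : ℝ) :
    0 < tr (gibbsWeight c V lam β μ) := by
  obtain ⟨B, hB, h⟩ := exists_isUnit_gibbsWeight_eq (c := c) (V := V) lam β μ
  rw [h]
  exact tr_star_mul_self_pos hB

theorem isState_gibbsState [Nontrivial 𝓗] (lam : Fin N → ℝ) (β μ : ℝ) :
    IsState (gibbsState c V lam β μ) := by
  have hZ := tr_gibbsWeight_pos (c := c) (V := V) lam β μ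
  obtain ⟨B, hB, h⟩ := exists_isUnit_gibbsWeight_eq (c := c) (V := V) lam β μ
  have hpos : (gibbsWeight c V lam β μ).IsPositive := h ▸ B.isPositive_adjoint_comp_self
  refine ⟨hpos.smul_of_nonneg ?_, ?_⟩
  · exact (RCLike.inv_pos_of_pos hZ).le
  · rw [gibbsState, tr_smul, inv_mul_cancel₀ hZ.ne']

end Gibbs

/-! ### Spectral projectors and Born's rule. -/

section Born

variable {𝓗 : Type*} [NormedAddCommGroup 𝓗] [InnerProductSpace ℂ 𝓗] [CompleteSpace 𝓗]
  [FiniteDimensional ℂ 𝓗]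

theorem isStarProjection_spectralProj (A : 𝓗 →L[ℂ] 𝓗) (x : ℝ) :
    IsStarProjection (spectralProj A x) :=
  isStarProjection_starProjection

theorem spectralProj_eq_of_range {A p : 𝓗 →L[ℂ] 𝓗} {x : ℝ} (hp : IsStarProjection p)
    (h : ∀ v, p v = v ↔ A v = (x : ℂ) • v) : spectralProj A x = p := by
  refine ContinuousLinearMap.IsStarProjection.ext (isStarProjection_spectralProj A x) hp ?_
  have h1 : (spectralProj A x).range = Module.End.eigenspace (A : 𝓗 →ₗ[ℂ] 𝓗) (x : ℂ) :=
    Submodule.range_starProjection _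
  rw [h1]
  ext v
  rw [Module.End.mem_eigenspace_iff]
  refine (h v).symm.trans ⟨fun hv => ⟨v, hv⟩, ?_⟩
  rintro ⟨w, rfl⟩
  exact congrArg (fun T : 𝓗 →L[ℂ] 𝓗 => T w) hp.isIdempotentElem

theorem spectralProj_one {A : 𝓗 →L[ℂ] 𝓗} (hA : IsStarProjection A) : spectralProj A 1 = A :=
  spectralProj_eq_of_range hA fun v => by simp

theorem spectralProj_zero {A : 𝓗 →L[ℂ] 𝓗} (hA : IsStarProjection A) :
    spectralProj A 0 = 1 - A :=
  spectralProj_eq_of_range hA.one_sub fun v => by simp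

theorem spectralProj_eq_zero {A : 𝓗 →L[ℂ] 𝓗} (hA : IsStarProjection A) {x : ℝ} (h0 : x ≠ 0)
    (h1 : x ≠ 1) : spectralProj A x = 0 := by
  refine spectralProj_eq_of_range (.zero _) fun v => ?_
  refine ⟨fun h => by rw [← h]; simp, fun h => ?_⟩
  have h2 : A (A v) = A v := congrArg (fun T : 𝓗 →L[ℂ] 𝓗 => T v) hA.isIdempotentElem
  rw [h, map_smul, h, smul_smul, ← sub_eq_zero, ← sub_smul, smul_eq_zero] at h2
  refine (h2.resolve_left ?_).symm
  have : (x : ℂ) * x - x = ((x * (x - 1) : ℝ) : ℂ) := by push_cast; ring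
  rw [this]
  exact Complex.ofReal_ne_zero.2 <| mul_ne_zero h0 (sub_ne_zero.2 h1)

theorem commute_spectralProj {A B : 𝓗 →L[ℂ] 𝓗} (hA : IsStarProjection A) (h : Commute A B)
    (x : ℝ) : Commute (spectralProj A x) B := by
  by_cases h0 : x = 0
  · rw [h0, spectralProj_zero hA]
    exact (Commute.one_left B).sub_left h
  by_cases h1 : x = 1
  · rwa [h1, spectralProj_one hA]
  · rw [spectralProj_eq_zero hA h0 h1]
    exact Commute.zero_left B

theorem isStarProjection_ofFn_prod {R : Type*} [Ring R] [StarRing R] {n : ℕ} {p : Fin n → R}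
    (hp : ∀ i, IsStarProjection (p i)) (h : ∀ i j, Commute (p i) (p j)) :
    IsStarProjection (List.ofFn p).prod := by
  induction n with
  | zero => simp
  | succ n ih =>
    rw [List.ofFn_succ, List.prod_cons]
    refine (hp 0).mul (ih (fun i => hp _) fun i j => h _ _) (Commute.list_prod_right _ _ ?_)
    intro x hx
    obtain ⟨a, rfl⟩ := List.mem_ofFn.1 hx
    exact h _ _

/-- Distributivity with the order of the factors kept, since operators need not commute. It lets
Born weights be summed one coordinate at a time. -/
theorem sum_piFinset_ofFn_prod {R α : Type*} [Semiring R] {n : ℕ}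
    (s : Fin n → Finset α) (f : Fin n → α → R) :
    ∑ x ∈ Fintype.piFinset s, (List.ofFn fun i => f i (x i)).prod =
      (List.ofFn fun i => ∑ a ∈ s i, f i a).prod := by
  classical
  induction n with
  | zero => simp
  | succ n ih =>
    rw [List.ofFn_succ, List.prod_cons, ← ih, Finset.sum_mul_sum, ← Finset.sum_product']
    symm
    refine Finset.sum_bij' (fun p _ => Fin.cons p.1 p.2) (fun x _ => (x 0, Fin.tail x))
      ?_ ?_ ?_ ?_ ?_
    · rintro ⟨a, x⟩ h
      simp only [Finset.mem_product, Fintype.mem_piFinset] at h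
      rw [Fintype.mem_piFinset, Fin.forall_fin_succ]
      simpa using h
    · intro x h
      rw [Fintype.mem_piFinset, Fin.forall_fin_succ] at h
      simpa [Fin.tail] using h
    · simp
    · simp
    · simp [List.ofFn_succ]

/-- Joint measurement of commuting orthogonal projections in a state: the Born law exists, is
supported on `{0, 1}`-valued vectors, and the inclusion probabilities of the set of indices with
outcome `1` are the expectations of the corresponding products of projections. -/
theorem IsState.exists_isBornLaw {N : ℕ} {ρ : 𝓗 →L[ℂ] 𝓗} (hρ : IsState ρ)
    {A : Fin N → 𝓗 →L[ℂ] 𝓗} (hA : ∀ i, IsStarProjection (A i))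
    (hcomm : ∀ i j, Commute (A i) (A j)) :
    ∃ P : PMF (Fin N → ℝ), IsBornLaw ρ A P ∧ (∀ x ∈ P.support, ∀ i, x i = 0 ∨ x i = 1) ∧
      ∀ S : Finset (Fin N),
        (((P.map occupied).toOuterMeasure {Y | S ⊆ Y}).toReal : ℂ) =
          expectation ρ (List.ofFn fun i => if i ∈ S then A i else 1).prod := by
  classical
  set Q : (Fin N → ℝ) → 𝓗 →L[ℂ] 𝓗 :=
    fun x => (List.ofFn fun j => spectralProj (A j) (x j)).prod with hQ
  have hQproj : ∀ x, IsStarProjection (Q x) := fun x =>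
    isStarProjection_ofFn_prod (fun i => isStarProjection_spectralProj _ _) fun i j =>
      commute_spectralProj (hA i)
        (commute_spectralProj (hA j) (hcomm j i) (x j)).symm (x i)
  have hnonneg : ∀ x, 0 ≤ expectation ρ (Q x) := fun x => expectation_nonneg hρ.1 (hQproj x)
  set q : (Fin N → ℝ) → ℝ := fun x => (expectation ρ (Q x)).re with hq
  have hqQ : ∀ x, (q x : ℂ) = expectation ρ (Q x) := fun x =>
    Complex.ext rfl (Complex.nonneg_iff.1 (hnonneg x)).2
  have hq0 : ∀ x, 0 ≤ q x := fun x => (Complex.nonneg_iff.1 (hnonneg x)).1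
  set s : Finset (Fin N → ℝ) := Fintype.piFinset fun _ => {0, 1} with hs
  have hmem : ∀ x, x ∈ s ↔ ∀ i, x i = 0 ∨ x i = 1 := fun x => by simp [hs]
  have hsum : ∀ S : Finset (Fin N), ∑ x ∈ s with S ⊆ occupied x, (q x : ℂ) =
      expectation ρ (List.ofFn fun i => if i ∈ S then A i else 1).prod := by
    intro S
    have h1 : (s.filter fun x => S ⊆ occupied x) =
        Fintype.piFinset fun i => if i ∈ S then ({1} : Finset ℝ) else {0, 1} := by
      ext x
      simp only [Finset.mem_filter, hmem, Fintype.mem_piFinset, occupied, Finset.subset_iff,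
        Finset.mem_univ, true_and, ← forall_and]
      refine forall_congr' fun i => ?_
      by_cases hi : i ∈ S <;> simp +contextual [hi]
    simp_rw [hqQ]
    rw [h1, ← map_sum, hQ, sum_piFinset_ofFn_prod _ fun i a => spectralProj (A i) a]
    congr 3
    -- A coordinate in `S` contributes `A i`; a free one contributes `(1 - A i) + A i = 1`.
    ext1 i
    by_cases hi : i ∈ S
    · simp [hi, spectralProj_one (hA i)]
    · simp [hi, spectralProj_one (hA i), spectralProj_zero (hA i)]
  have hsum_one : ∑ x ∈ s, q x = 1 := by
    -- The case `S = ∅` is the normalisation of the weights.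
    have h := hsum ∅
    simp only [Finset.empty_subset, Finset.filter_true, Finset.notMem_empty, if_false] at h
    have h2 : (List.ofFn fun _ : Fin N => (1 : 𝓗 →L[ℂ] 𝓗)).prod = 1 := by simp
    rw [h2, expectation_apply, mul_one, hρ.2] at h
    exact_mod_cast h
  have hzero : ∀ x, x ∉ s → q x = 0 := by
    intro x hx
    simp only [hmem, not_forall, not_or] at hx
    obtain ⟨i, h0, h1⟩ := hx
    have : Q x = 0 := List.prod_eq_zero <|
      List.mem_ofFn.2 ⟨i, spectralProj_eq_zero (hA i) h0 h1⟩
    simp [hq, this]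
  refine ⟨PMF.ofFinset (fun x => ENNReal.ofReal (q x)) s ?_ fun x hx => by simp [hzero x hx],
    fun x => ?_, fun x hx => ?_, fun S => ?_⟩
  · rw [← ENNReal.ofReal_sum_of_nonneg fun x _ => hq0 x, hsum_one, ENNReal.ofReal_one]
  · rw [PMF.ofFinset_apply, ENNReal.toReal_ofReal (hq0 x), hqQ, expectation_apply]
  · rw [PMF.mem_support_ofFinset_iff] at hx
    exact (hmem x).1 hx.1
  · rw [PMF.toOuterMeasure_map_apply, ← hsum, ← Complex.ofReal_sum]
    congr 1
    rw [PMF.toOuterMeasure_apply_eq_of_inter_support_eq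
      (t := ((s.filter fun x => S ⊆ occupied x : Finset _) : Set (Fin N → ℝ))),
      PMF.toOuterMeasure_apply_finset]
    · simp_rw [PMF.ofFinset_apply]
      rw [← ENNReal.ofReal_sum_of_nonneg fun x _ => hq0 x,
        ENNReal.toReal_ofReal (Finset.sum_nonneg fun x _ => hq0 x)]
    · ext x
      simp only [Set.mem_inter_iff, Set.mem_preimage, Set.mem_ofPred_eq, Finset.coe_filter,
        PMF.mem_support_ofFinset_iff]
      tauto

end Born

/-! ### Determinantal correlations and the zero-temperature limit. -/

section Main

variable {𝓗 : Type*} [NormedAddCommGroup 𝓗] [InnerProductSpace ℂ 𝓗] [CompleteSpace 𝓗]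
variable {N : ℕ} {c : Fin N → 𝓗 →L[ℂ] 𝓗} {V : Matrix (Fin N) (Fin N) ℂ}

theorem _root_.List.prod_map_ite_one_eq_prod_filter {α M : Type*} [Monoid M] (p : α → Prop)
    [DecidablePred p] (f : α → M) (l : List α) :
    (l.map fun a => if p a then f a else 1).prod = ((l.filter fun a => p a).map f).prod := by
  induction l with
  | nil => simp
  | cons a l ih => by_cases h : p a <;> simp [h, ih]

theorem SatisfiesCAR.wick_numberOp (hc : SatisfiesCAR c)
    (hV : V ∈ Matrix.unitaryGroup (Fin N) ℂ)
    (d : Fin N → ℝ) (φ : (𝓗 →L[ℂ] 𝓗) →ₗ[ℂ] ℂ) (hφ1 : φ 1 = 1)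
    (hφ : ∀ k X, φ (star (modeOp c V k) * X) =
      d k * (φ (star (modeOp c V k) * X) + φ (X * star (modeOp c V k))))
    (S : Finset (Fin N)) :
    φ (List.ofFn fun i => if i ∈ S then numberOp c i else 1).prod =
      ((hermitianOf V d).submatrix (fun i : S => (i : Fin N)) (fun i : S => (i : Fin N))).det := by
  set l := (List.finRange N).filter fun i => i ∈ S with hl
  have hnodup : l.Nodup := (List.nodup_finRange N).filter _
  have hmem : ∀ i, i ∈ l ↔ i ∈ S := fun i => by simp [hl]
  have h1 : (List.ofFn fun i => if i ∈ S then numberOp c i else 1).prod =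
      (List.ofFn fun a => numberOp c (l.get a)).prod := by
    rw [List.ofFn_eq_map, List.prod_map_ite_one_eq_prod_filter, ← hl]
    congr 1
    conv_lhs => rw [← List.ofFn_get l, List.map_ofFn]
    rfl
  -- Rows and columns are reindexed by the same bijection, which leaves the determinant unchanged.
  let e : Fin l.length ≃ S := (hnodup.getEquiv l).trans (Equiv.subtypeEquivRight hmem)
  rw [h1, ← hc.creationString_mul_star _ hnodup.injective_get, hc.wick hV d φ hφ1 hφ,
    ← Matrix.det_submatrix_equiv_self e]
  rfl

theorem tendsto_hermitianOf {lam : Fin N → ℝ} (hlam : Monotone lam) {μ : ℝ} {r : ℕ} (hr : r ≤ N)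
    (hlt : ∀ i : Fin N, (i : ℕ) + 1 = r → lam i < μ)
    (hgt : ∀ i : Fin N, (i : ℕ) = r → μ < lam i) {d : ℝ → Fin N → ℝ}
    (hd : ∀ β, 0 < β → ∀ i, 0 < d β i ∧ d β i < 1 ∧
      β * (lam i - μ) = Real.log ((1 - d β i) / d β i)) :
    Filter.Tendsto (fun β => hermitianOf V (d β)) Filter.atTop
      (nhds (firstColumnsProj V hr)) := by
  -- Indices start at 0: `λ_r` sits at `r - 1` and `λ_{r+1}` at `r`. Monotonicity spreads the gap at
  -- `μ` to all indices.
  have hlt' : ∀ i : Fin N, (i : ℕ) < r → lam i < μ := fun i hi =>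
    (hlam (show i ≤ ⟨r - 1, by omega⟩ from Fin.le_def.2 (by simp; omega))).trans_lt
      (hlt _ (by simp; omega))
  have hgt' : ∀ i : Fin N, r ≤ (i : ℕ) → μ < lam i := fun i hi =>
    (hgt ⟨r, by omega⟩ rfl).trans_le (hlam (Fin.le_def.2 hi))
  have hd_eq : ∀ β, 0 < β → ∀ i, d β i = (1 + Real.exp (β * (lam i - μ)))⁻¹ := by
    intro β hβ i
    obtain ⟨h0, h1, h⟩ := hd β hβ i
    rw [h, Real.exp_log (div_pos (by linarith) h0)]
    field_simp
    ring
  have hlim : ∀ i : Fin N, Filter.Tendsto (fun β => d β i) Filter.atTop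
      (nhds (if (i : ℕ) < r then 1 else 0)) := by
    intro i
    have heq : (fun β => (1 + Real.exp (β * (lam i - μ)))⁻¹) =ᶠ[Filter.atTop] fun β => d β i :=
      (Filter.eventually_gt_atTop 0).mono fun β hβ => (hd_eq β hβ i).symm
    refine Filter.Tendsto.congr' heq ?_
    split_ifs with hi
    · have h1 : Filter.Tendsto (fun β : ℝ => Real.exp (β * (lam i - μ))) Filter.atTop (nhds 0) :=
        Real.tendsto_exp_atBot.comp
          (Filter.tendsto_id.atTop_mul_const_of_neg (sub_neg.2 (hlt' i hi)))
      simpa using (h1.const_add 1).inv₀ (by norm_num)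
    · have h1 : Filter.Tendsto (fun β : ℝ => Real.exp (β * (lam i - μ))) Filter.atTop
          Filter.atTop :=
        Real.tendsto_exp_atTop.comp
          (Filter.tendsto_id.atTop_mul_const (sub_pos.2 (hgt' i (not_lt.1 hi))))
      exact tendsto_inv_atTop_zero.comp (Filter.tendsto_atTop_add_const_left _ 1 h1)
  have hproj : firstColumnsProj V hr = hermitianOf V fun i => if (i : ℕ) < r then 1 else 0 := by
    ext i j
    rw [firstColumnsProj, hermitianOf, Matrix.mul_apply, Matrix.mul_apply]
    simp only [Matrix.submatrix_apply, Matrix.conjTranspose_apply, Matrix.mul_diagonal, id]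
    refine Finset.sum_of_injOn (Fin.castLE hr) (Fin.castLE_injective hr).injOn (by simp) ?_ ?_
    · intro k _ hk
      have : ¬ (k : ℕ) < r := fun hkr => hk ⟨⟨k, hkr⟩, by simp⟩
      simp [this]
    · intro k _
      simp
  rw [hproj]
  have hcont : Continuous fun d : Fin N → ℝ => hermitianOf V d := by
    unfold hermitianOf
    fun_prop
  exact (hcont.tendsto _).comp (tendsto_pi_nhds.2 hlim)

end Main

end Fermion

theorem mainTheorem10 {N : ℕ} {𝓗 : Type*} [NormedAddCommGroup 𝓗] [InnerProductSpace ℂ 𝓗]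
    [CompleteSpace 𝓗] [FiniteDimensional ℂ 𝓗] (hdim : Module.finrank ℂ 𝓗 = 2 ^ N)
    (c : Fin N → 𝓗 →L[ℂ] 𝓗) (hc : Fermion.SatisfiesCAR c)
    (V : Matrix (Fin N) (Fin N) ℂ) (hV : V ∈ Matrix.unitaryGroup (Fin N) ℂ) :
    (∀ d : Fin N → ℝ, (∀ i, 0 < d i ∧ d i < 1) →
      ∀ β μ : ℝ, 0 < β → ∀ lam : Fin N → ℝ,
        (∀ i, β * (lam i - μ) = Real.log ((1 - d i) / d i)) →
        Fermion.IsState (Fermion.gibbsState c V lam β μ) ∧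
        (∀ i, IsStarProjection (Fermion.numberOp c i)) ∧
        (∀ i j, Commute (Fermion.numberOp c i) (Fermion.numberOp c j)) ∧
        ∃ P : PMF (Fin N → ℝ),
          Fermion.IsBornLaw (Fermion.gibbsState c V lam β μ) (Fermion.numberOp c) P ∧
          (∀ x ∈ P.support, ∀ i, x i = 0 ∨ x i = 1) ∧
          Fermion.IsDPP (Fermion.hermitianOf V d) (P.map Fermion.occupied)) ∧
    (∀ lam : Fin N → ℝ, Monotone lam → ∀ (μ : ℝ) (r : ℕ) (hr : r ≤ N),
      (∀ i : Fin N, (i : ℕ) + 1 = r → lam i < μ) →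
      (∀ i : Fin N, (i : ℕ) = r → μ < lam i) →
      ∀ d : ℝ → Fin N → ℝ,
        (∀ β, 0 < β → ∀ i, 0 < d β i ∧ d β i < 1 ∧
          β * (lam i - μ) = Real.log ((1 - d β i) / d β i)) →
        Filter.Tendsto (fun β => Fermion.hermitianOf V (d β)) Filter.atTop
          (nhds (Fermion.firstColumnsProj V hr))) := by

  have : Nontrivial 𝓗 := Module.nontrivial_of_finrank_pos (R := ℂ) (by rw [hdim]; positivity)
  refine ⟨fun d hd β μ _ lam hlam => ?_, fun lam hlam μ r hr hlt hgt d hd =>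
    Fermion.tendsto_hermitianOf hlam hr hlt hgt hd⟩
  have hρ := Fermion.isState_gibbsState (c := c) (V := V) lam β μ
  obtain ⟨P, hP, hsupp, hincl⟩ := hρ.exists_isBornLaw hc.isStarProjection_numberOp
    hc.commute_numberOp
  refine ⟨hρ, hc.isStarProjection_numberOp, hc.commute_numberOp, P, hP, hsupp, fun S => ?_⟩
  rw [hincl]
  exact hc.wick_numberOp hV d _ (by rw [Fermion.expectation_apply, mul_one, hρ.2])
    (hc.expectation_star_modeOp_mul hV hd hlam) S
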